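/- Let $n\ge 3$ and let $(M,g)$ be a nonempty smooth $n$-dimensional pseudo-Riemannian manifold with Levi-Civita connection $\nabla$. Let $\mathcal R(X,Y)Z=\nabla_Y\nabla_XZ-\nabla_X\nabla_YZ+\nabla_{[X,Y]}Z$ be its curvature tensor, $\mathcal R(X,Y,Z,V)=g(\mathcal R(X,Y)Z,V)$ with components $\mathcal R_{ijkl}$, $\mathcal R_{jl}=g^{ik}\mathcal R_{ijkl}$ its Ricci tensor and $\tau=g^{jl}\mathcal R_{jl}$ its scalar curvature. Let $$\mathcal C_{ijkl}=\mathcal R_{ijkl}-\frac{\tau}{n(n-1)}\left(g_{ik}g_{jl}-g_{jk}g_{il}\right)$$ be the concircular curvature tensor and, for real constants $a_0,a_1,a_2,a_3$ with $a_0\neq 0$, let $$\mathcal K_{ijkl}=a_0\mathcal R_{ijkl}+a_1g_{ij}g_{kl}+a_2g_{ik}g_{jl}+a_3g_{jk}g_{il}.$$ Theorem. Suppose that $\mathcal K$ vanishes at every point of $M$. Then $M$ has constant sectional curvature (there is $\kappa\in\mathbb R$ such that every nondegenerate tangent plane, spanned by $u,v$, has $\frac{\mathcal R(u,v,u,v)}{g(u,u)g(v,v)-g(u,v)^2}=\kappa$),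 $$a_1=0,\qquad a_2=-a_3=\frac{-a_0\,\tau}{n(n-1)}\quad\text{at every point of } M,$$ and $\mathcal K=a_0\,\mathcal C$; in particular $\mathcal K$ is a constant multiple of $\mathcal C$. -/

import Mathlib

open scoped Manifold ContDiff

noncomputable section

namespace PseudoRiemannian

variable {n : ℕ} {M : Type*} [TopologicalSpace M] [ChartedSpace (EuclideanSpace ℝ (Fin n)) M]

/-- Vector fields on `M`, with no regularity imposed. -/
abbrev VField (n : ℕ) (M : Type*) [TopologicalSpace M]
    [ChartedSpace (EuclideanSpace ℝ (Fin n)) M] : Type _ :=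
  (x : M) → TangentSpace (𝓡 n) x

/-- A pseudo-Riemannian metric: a smooth field of symmetric nondegenerate bilinear forms on the
tangent spaces of `M`. -/
structure Metric (n : ℕ) (M : Type*) [TopologicalSpace M]
    [ChartedSpace (EuclideanSpace ℝ (Fin n)) M] [IsManifold (𝓡 n) ∞ M] where
  /-- the bilinear form on the tangent space at `x` -/
  val (x : M) : TangentSpace (𝓡 n) x →L[ℝ] TangentSpace (𝓡 n) x →L[ℝ] ℝ
  symm (x : M) (v w : TangentSpace (𝓡 n) x) : val x v w = val x w v
  nondegenerate (x : M) (v : TangentSpace (𝓡 n) x) : (∀ w, val x v w = 0) → v = 0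
  contMDiff : ContMDiff (𝓡 n) ((𝓡 n).prod 𝓘(ℝ,
      EuclideanSpace ℝ (Fin n) →L[ℝ] EuclideanSpace ℝ (Fin n) →L[ℝ] ℝ)) ∞
    (fun x ↦ Bundle.TotalSpace.mk'
      (EuclideanSpace ℝ (Fin n) →L[ℝ] EuclideanSpace ℝ (Fin n) →L[ℝ] ℝ)
      (E := fun x : M ↦ TangentSpace (𝓡 n) x →L[ℝ] TangentSpace (𝓡 n) x →L[ℝ] ℝ) x (val x))

variable [IsManifold (𝓡 n) ∞ M]

/-- The vector field `X` is differentiable at `x`. -/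
abbrev DiffAt (X : VField n M) (x : M) : Prop :=
  MDifferentiableAt (𝓡 n) ((𝓡 n).prod (𝓡 n))
    (fun y ↦ Bundle.TotalSpace.mk' (EuclideanSpace ℝ (Fin n))
      (E := (TangentSpace (𝓡 n) : M → Type _)) y (X y)) x

namespace Metric

variable (g : Metric n M)

/-- The function `g(X, Y)` for vector fields `X` and `Y`. -/
def pair (X Y : VField n M) (x : M) : ℝ := g.val x (X x) (Y x)

/-- The right-hand side of the Koszul formula for `g(∇_X Y, Z)` at the point `x`. -/
def koszul (X Y Z : VField n M) (x : M) : ℝ :=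
  2⁻¹ * (mvfderiv (𝓡 n) (g.pair Y Z) x (X x) + mvfderiv (𝓡 n) (g.pair X Z) x (Y x)
    - mvfderiv (𝓡 n) (g.pair X Y) x (Z x)
    + g.val x (VectorField.mlieBracket (𝓡 n) X Y x) (Z x)
    - g.val x (VectorField.mlieBracket (𝓡 n) X Z x) (Y x)
    - g.val x (VectorField.mlieBracket (𝓡 n) Y Z x) (X x))

lemma mdifferentiableAt_pair {X Y : VField n M} {x : M}
    (hX : DiffAt X x) (hY : DiffAt Y x) :
    MDifferentiableAt (𝓡 n) 𝓘(ℝ) (g.pair X Y) x := by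
  have : MDifferentiableAt (𝓡 n) ((𝓡 n).prod 𝓘(ℝ))
      (fun m ↦ Bundle.TotalSpace.mk' ℝ (E := Bundle.Trivial M ℝ) m (g.val m (X m) (Y m))) x := by
    apply MDifferentiableAt.clm_bundle_apply₂ (F₁ := EuclideanSpace ℝ (Fin n))
      (F₂ := EuclideanSpace ℝ (Fin n))
    · exact g.contMDiff.mdifferentiableAt (by simp)
    · exact hX
    · exact hY
  simp only [mdifferentiableAt_totalSpace] at this
  exact this.2

lemma pair_add_left (X X' Y : VField n M) : g.pair (X + X') Y = g.pair X Y + g.pair X' Y := by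
  ext x; simp [pair]

lemma pair_add_right (X Y Y' : VField n M) : g.pair X (Y + Y') = g.pair X Y + g.pair X Y' := by
  ext x; simp [pair]

lemma pair_smul_left (f : M → ℝ) (X Y : VField n M) : g.pair (f • X) Y = f * g.pair X Y := by
  ext x; simp [pair]

lemma pair_smul_right (f : M → ℝ) (X Y : VField n M) : g.pair X (f • Y) = f * g.pair X Y := by
  ext x; simp [pair]

lemma pair_comm (X Y : VField n M) : g.pair X Y = g.pair Y X := by
  ext x; exact g.symm x _ _

lemma koszul_tensorial_left {Y Z : VField n M} {x : M} (hY : DiffAt Y x) (hZ : DiffAt Z x) :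
    TensorialAt (𝓡 n) (EuclideanSpace ℝ (Fin n)) (fun X : VField n M ↦ g.koszul X Y Z x) x where
  smul {f X} hf hX := by
    simp only [koszul, pair_smul_left, VectorField.mlieBracket_smul_left hf hX,
      mvfderiv_mul hf (g.mdifferentiableAt_pair hX hZ),
      mvfderiv_mul hf (g.mdifferentiableAt_pair hX hY)]
    simp [pair]
    ring
  add {X X'} hX hX' := by
    simp only [koszul, pair_add_left, VectorField.mlieBracket_add_left hX hX',
      mvfderiv_add (g.mdifferentiableAt_pair hX hZ) (g.mdifferentiableAt_pair hX' hZ),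
      mvfderiv_add (g.mdifferentiableAt_pair hX hY) (g.mdifferentiableAt_pair hX' hY)]
    simp
    ring

lemma koszul_tensorial_right {X Y : VField n M} {x : M} (hX : DiffAt X x) (hY : DiffAt Y x) :
    TensorialAt (𝓡 n) (EuclideanSpace ℝ (Fin n)) (fun Z : VField n M ↦ g.koszul X Y Z x) x where
  smul {f Z} hf hZ := by
    simp only [koszul, pair_smul_right, VectorField.mlieBracket_smul_right hf hZ,
      mvfderiv_mul hf (g.mdifferentiableAt_pair hX hZ),
      mvfderiv_mul hf (g.mdifferentiableAt_pair hY hZ)]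
    simp [pair]
    rw [g.symm x (Z x) (Y x), g.symm x (Z x) (X x)]
    ring
  add {Z Z'} hZ hZ' := by
    simp only [koszul, pair_add_right, VectorField.mlieBracket_add_right hZ hZ',
      mvfderiv_add (g.mdifferentiableAt_pair hX hZ) (g.mdifferentiableAt_pair hX hZ'),
      mvfderiv_add (g.mdifferentiableAt_pair hY hZ) (g.mdifferentiableAt_pair hY hZ')]
    simp
    ring

lemma koszul_add {X Y Y' Z : VField n M} {x : M} (hX : DiffAt X x) (hY : DiffAt Y x)
    (hY' : DiffAt Y' x) (hZ : DiffAt Z x) :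
    g.koszul X (Y + Y') Z x = g.koszul X Y Z x + g.koszul X Y' Z x := by
  simp only [koszul, pair_add_left, pair_add_right, VectorField.mlieBracket_add_right hY hY',
    VectorField.mlieBracket_add_left hY hY',
    mvfderiv_add (g.mdifferentiableAt_pair hX hY) (g.mdifferentiableAt_pair hX hY'),
    mvfderiv_add (g.mdifferentiableAt_pair hY hZ) (g.mdifferentiableAt_pair hY' hZ)]
  simp
  ring

lemma koszul_smul {f : M → ℝ} {X Y Z : VField n M} {x : M}
    (hf : MDifferentiableAt (𝓡 n) 𝓘(ℝ) f x) (hX : DiffAt X x) (hY : DiffAt Y x)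
    (hZ : DiffAt Z x) :
    g.koszul X (f • Y) Z x =
      f x * g.koszul X Y Z x + mvfderiv (𝓡 n) f x (X x) * g.val x (Y x) (Z x) := by
  simp only [koszul, pair_smul_left, pair_smul_right, VectorField.mlieBracket_smul_right hf hY,
    VectorField.mlieBracket_smul_left hf hY,
    mvfderiv_mul hf (g.mdifferentiableAt_pair hX hY),
    mvfderiv_mul hf (g.mdifferentiableAt_pair hY hZ)]
  simp [pair]
  rw [g.symm x (Y x) (X x)]
  ring

/-- The Koszul expression at `x`, as a bilinear form in the values at `x` of `X` and `Z`. -/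
def koszulHom {Y : VField n M} {x : M} (hY : DiffAt Y x) :
    TangentSpace (𝓡 n) x →L[ℝ] TangentSpace (𝓡 n) x →L[ℝ] ℝ :=
  TensorialAt.mkHom₂ (fun X Z : VField n M ↦ g.koszul X Y Z x) x
    (fun _ hZ ↦ g.koszul_tensorial_left hY hZ) (fun _ hX ↦ g.koszul_tensorial_right hX hY)

lemma koszulHom_apply {X Y Z : VField n M} {x : M} (hX : DiffAt X x) (hY : DiffAt Y x)
    (hZ : DiffAt Z x) : g.koszulHom hY (X x) (Z x) = g.koszul X Y Z x :=
  TensorialAt.mkHom₂_apply (fun _ hZ ↦ g.koszul_tensorial_left hY hZ)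
    (fun _ hX ↦ g.koszul_tensorial_right hX hY) hX hZ

lemma val_injective (x : M) : Function.Injective (g.val x) := by
  rw [injective_iff_map_eq_zero]
  intro v hv
  exact g.nondegenerate x v fun w ↦ by rw [hv]; rfl

instance (x : M) : FiniteDimensional ℝ (TangentSpace (𝓡 n) x) :=
  inferInstanceAs (FiniteDimensional ℝ (EuclideanSpace ℝ (Fin n)))

instance (x : M) : T2Space (TangentSpace (𝓡 n) x) :=
  inferInstanceAs (T2Space (EuclideanSpace ℝ (Fin n)))

/-- The isomorphism between tangent vectors and covectors given by the metric. -/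
def flat (x : M) : TangentSpace (𝓡 n) x ≃ₗ[ℝ] (TangentSpace (𝓡 n) x →L[ℝ] ℝ) :=
  LinearEquiv.ofInjectiveOfFinrankEq (g.val x).toLinearMap (g.val_injective x) (by
    rw [← LinearMap.toContinuousLinearMap.finrank_eq, Subspace.dual_finrank_eq])

lemma val_flat_symm (x : M) (φ : TangentSpace (𝓡 n) x →L[ℝ] ℝ) (w : TangentSpace (𝓡 n) x) :
    g.val x ((g.flat x).symm φ) w = φ w :=
  DFunLike.congr_fun ((g.flat x).apply_symm_apply φ) w

open scoped Classical in
/-- The covariant differential `∇ Y` at the point `x`, a linear map in the direction of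
differentiation: `g(∇_X Y, Z)` is given by the Koszul formula if `Y` is differentiable at `x` (and
`∇ Y` has the junk value `0` at the other points). -/
def nabla (Y : VField n M) (x : M) : TangentSpace (𝓡 n) x →L[ℝ] TangentSpace (𝓡 n) x :=
  if hY : DiffAt Y x then
    ((g.flat x).symm.toLinearMap ∘ₗ (g.koszulHom hY).toLinearMap).toContinuousLinearMap
  else 0

lemma val_nabla {X Y Z : VField n M} {x : M} (hX : DiffAt X x) (hY : DiffAt Y x)
    (hZ : DiffAt Z x) : g.val x (g.nabla Y x (X x)) (Z x) = g.koszul X Y Z x := by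
  rw [← g.koszulHom_apply hX hY hZ, nabla, dif_pos hY]
  exact g.val_flat_symm x _ _

lemma diffAt_extend {x : M} (v : TangentSpace (𝓡 n) x) :
    DiffAt (FiberBundle.extend (EuclideanSpace ℝ (Fin n)) v) x :=
  FiberBundle.mdifferentiableAt_extend (𝓡 n) (EuclideanSpace ℝ (Fin n)) v

lemma ext_val {x : M} {v v' : TangentSpace (𝓡 n) x}
    (h : ∀ Z : VField n M, DiffAt Z x → g.val x v (Z x) = g.val x v' (Z x)) : v = v' := by
  apply g.val_injective x
  ext w
  have := h _ (diffAt_extend w)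
  rwa [FiberBundle.extend_apply_self] at this

lemma ext_clm {x : M} {A B : TangentSpace (𝓡 n) x →L[ℝ] TangentSpace (𝓡 n) x}
    (h : ∀ X Z : VField n M, DiffAt X x → DiffAt Z x →
      g.val x (A (X x)) (Z x) = g.val x (B (X x)) (Z x)) : A = B := by
  ext1 v
  refine g.ext_val fun Z hZ ↦ ?_
  have := h _ Z (diffAt_extend v) hZ
  rwa [FiberBundle.extend_apply_self] at this

/-- The Levi-Civita connection of a pseudo-Riemannian metric. -/
def leviCivita : CovariantDerivative (𝓡 n) (EuclideanSpace ℝ (Fin n))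
    (TangentSpace (𝓡 n) : M → Type _) where
  toFun := g.nabla
  isCovariantDerivativeOnUniv :=
    { add := by
        intro Y Y' x hY hY' _
        refine g.ext_clm fun X Z hX hZ ↦ ?_
        rw [g.val_nabla hX (mdifferentiableAt_add_section hY hY') hZ, g.koszul_add hX hY hY' hZ,
          add_apply, map_add, add_apply,
          g.val_nabla hX hY hZ, g.val_nabla hX hY' hZ]
      leibniz := by
        intro Y f x hY hf _
        refine g.ext_clm fun X Z hX hZ ↦ ?_
        rw [g.val_nabla hX (hf.smul_section hY) hZ, g.koszul_smul hf hX hY hZ]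
        simp [g.val_nabla hX hY hZ] }

theorem leviCivita_torsion : g.leviCivita.torsion = 0 := by
  rw [CovariantDerivative.torsion_eq_zero_iff]
  intro X Y x hX hY
  refine g.ext_val fun Z hZ ↦ ?_
  have h1 := g.val_nabla hX hY hZ
  have h2 := g.val_nabla hY hX hZ
  rw [map_sub, sub_apply]
  refine (congrArg₂ (· - ·) h1 h2).trans ?_
  simp only [koszul, g.pair_comm Y X, VectorField.mlieBracket_swap_apply (V := Y) (W := X)]
  simp
  ring

theorem leviCivita_metric {X Y Z : VField n M} {x : M} (hX : DiffAt X x) (hY : DiffAt Y x)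
    (hZ : DiffAt Z x) :
    mvfderiv (𝓡 n) (g.pair Y Z) x (X x) =
      g.val x (g.leviCivita Y x (X x)) (Z x) + g.val x (Y x) (g.leviCivita Z x (X x)) := by
  rw [g.symm x (Y x)]
  refine Eq.trans ?_ (congrArg₂ (· + ·) (g.val_nabla hX hY hZ) (g.val_nabla hX hZ hY)).symm
  simp only [koszul, g.pair_comm Z Y, VectorField.mlieBracket_swap_apply (V := Z) (W := Y)]
  simp
  ring

/-- The curvature operator `R(X, Y)Z = ∇_Y ∇_X Z - ∇_X ∇_Y Z + ∇_[X,Y] Z` on vector fields. -/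
def curvatureField (X Y Z : VField n M) : VField n M := fun x ↦
  g.leviCivita (fun y ↦ g.leviCivita Z y (X y)) x (Y x)
    - g.leviCivita (fun y ↦ g.leviCivita Z y (Y y)) x (X x)
    + g.leviCivita Z x (VectorField.mlieBracket (𝓡 n) X Y x)

/-- The `(0,4)` curvature tensor `R(u, v, w, z) = g(R(u, v)w, z)` at the point `p`. The curvature
operator is tensorial, so its value at `p` may be computed with any smooth extensions of the tangent
vectors; `FiberBundle.extend` is the extension with constant coordinates in the chart at `p`. -/
def curvature (p : M) (u v w z : TangentSpace (𝓡 n) p) : ℝ :=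
  g.val p (g.curvatureField (FiberBundle.extend (EuclideanSpace ℝ (Fin n)) u)
    (FiberBundle.extend (EuclideanSpace ℝ (Fin n)) v)
    (FiberBundle.extend (EuclideanSpace ℝ (Fin n)) w) p) z

/-- The coordinate basis of the tangent space at `p` (for the chart at `p`). -/
def frame (p : M) : Module.Basis (Fin n) ℝ (TangentSpace (𝓡 n) p) :=
  (EuclideanSpace.basisFun (Fin n) ℝ).toBasis

/-- The inverse `g^{ij}` of the matrix `g_{ij}` of the metric at `p`. -/
def inv (p : M) : Matrix (Fin n) (Fin n) ℝ :=
  (Matrix.of fun i j ↦ g.val p (frame p i) (frame p j))⁻¹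

/-- The Ricci tensor `R_{jl} = g^{ik} R_{ijkl}`. -/
def ricci (p : M) (v z : TangentSpace (𝓡 n) p) : ℝ :=
  ∑ i, ∑ k, g.inv p i k * g.curvature p (frame p i) v (frame p k) z

/-- The scalar curvature `τ = g^{jl} R_{jl}`. -/
def scalarCurvature (p : M) : ℝ :=
  ∑ j, ∑ l, g.inv p j l * g.ricci p (frame p j) (frame p l)

/-- `g(u, u) g(v, v) - g(u, v)²`; it is nonzero exactly when `u` and `v` span a nondegenerate
plane. -/
def area (p : M) (u v : TangentSpace (𝓡 n) p) : ℝ :=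
  g.val p u u * g.val p v v - g.val p u v ^ 2

/-- The sectional curvature of the plane spanned by `u` and `v` (positive on round spheres, with
the sign convention of `curvatureField`). -/
def sectionalCurvature (p : M) (u v : TangentSpace (𝓡 n) p) : ℝ :=
  g.curvature p u v u v / g.area p u v

/-- The metric has constant curvature: all nondegenerate tangent planes at all points have the same
sectional curvature. -/
def IsConstantCurvature : Prop :=
  ∃ κ : ℝ, ∀ (p : M) (u v : TangentSpace (𝓡 n) p), g.area p u v ≠ 0 →
    g.sectionalCurvature p u v = κ

/-- The concircular curvature tensor
`C_{ijkl} = R_{ijkl} - τ / (n (n - 1)) (g_{ik} g_{jl} - g_{jk} g_{il})`. -/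
def concircular (p : M) (u v w z : TangentSpace (𝓡 n) p) : ℝ :=
  g.curvature p u v w z - g.scalarCurvature p / ((n : ℝ) * ((n : ℝ) - 1)) *
    (g.val p u w * g.val p v z - g.val p v w * g.val p u z)

/-- The tensor
`K_{ijkl} = a₀ R_{ijkl} + a₁ g_{ij} g_{kl} + a₂ g_{ik} g_{jl} + a₃ g_{jk} g_{il}`. -/
def genTensor (a₀ a₁ a₂ a₃ : ℝ) (p : M) (u v w z : TangentSpace (𝓡 n) p) : ℝ :=
  a₀ * g.curvature p u v w z + a₁ * (g.val p u v * g.val p w z)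
    + a₂ * (g.val p u w * g.val p v z) + a₃ * (g.val p v w * g.val p u z)

end Metric

end PseudoRiemannian

end

namespace PseudoRiemannian.Metric

variable {n : ℕ} {M : Type*} [TopologicalSpace M] [ChartedSpace (EuclideanSpace ℝ (Fin n)) M]
  [IsManifold (𝓡 n) ∞ M] (g : Metric n M)

/-! The curvature is antisymmetric in its first two arguments, so symmetrising `K = 0` in them
removes it and leaves an identity in the metric alone. Testing this identity on two orthogonal
non-null vectors gives `a₁ = 0` and `a₂ = -a₃` (`coeff_of_genTensor_eq_zero`). Dividing by `a₀` then
puts the curvature in constant-curvature form with factor `-a₂ / a₀`. This factor does not depend on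
the point, because the coefficients are constants, so Schur's lemma is not needed. Contracting twice
(`scalarCurvature_of_curvature_eq`) identifies the factor with `τ / (n (n - 1))`, and the remaining
claims follow by substitution. -/

/-- The curvature tensor is antisymmetric in its first two arguments. -/
lemma curvature_swap (p : M) (u v w z : TangentSpace (𝓡 n) p) :
    g.curvature p v u w z = -g.curvature p u v w z := by
  set X := FiberBundle.extend (EuclideanSpace ℝ (Fin n)) u
  set Y := FiberBundle.extend (EuclideanSpace ℝ (Fin n)) v
  -- The two second-order terms trade places and the bracket changes sign; neither the metric
  -- property nor the vanishing torsion enters.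
  have h (Z : VField n M) : g.curvatureField Y X Z p = -g.curvatureField X Y Z p := by
    simp only [curvatureField]
    rw [VectorField.mlieBracket_swap_apply (V := Y) (W := X), map_neg]
    abel
  rw [curvature, curvature, h, map_neg, neg_apply]

/-- The metric at a point, as a bilinear form. -/
noncomputable def bilinForm (p : M) : LinearMap.BilinForm ℝ (TangentSpace (𝓡 n) p) :=
  LinearMap.mk₂ ℝ (fun u v ↦ g.val p u v) (by simp) (by simp) (by simp) (by simp)

@[simp] lemma bilinForm_apply (p : M) (u v : TangentSpace (𝓡 n) p) :
    g.bilinForm p u v = g.val p u v := rfl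

lemma bilinForm_isSymm (p : M) : LinearMap.IsSymm (g.bilinForm p) := ⟨fun u v ↦ g.symm p u v⟩

lemma bilinForm_nondegenerate (p : M) : (g.bilinForm p).Nondegenerate := by
  refine ⟨fun v hv ↦ g.nondegenerate p v hv, fun v hv ↦ g.nondegenerate p v fun w ↦ ?_⟩
  rw [g.symm]
  exact hv w

/-- In dimension at least two there are two orthogonal non-null tangent vectors. -/
lemma exists_orthogonal_pair (hn : 2 ≤ n) (p : M) : ∃ u v : TangentSpace (𝓡 n) p,
    g.val p u v = 0 ∧ g.val p u u ≠ 0 ∧ g.val p v v ≠ 0 := by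
  obtain ⟨b, hb⟩ := LinearMap.BilinForm.exists_orthogonal_basis (g.bilinForm_isSymm p)
  -- The basis `b` is indexed by `Fin (finrank ..)`; `hd` lets `omega` see that 0 and 1 are valid
  -- indices.
  have hd : Module.finrank ℝ (TangentSpace (𝓡 n) p) = n := by
    simpa using Module.finrank_eq_card_basis (frame p)
  -- A null vector of an orthogonal basis would be orthogonal to everything, against nondegeneracy.
  have hself := hb.not_isOrtho_basis_self_of_separatingLeft (g.bilinForm_nondegenerate p).1
  refine ⟨b ⟨0, by omega⟩, b ⟨1, by omega⟩, ?_, hself _, hself _⟩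
  exact hb (by simp)

/-- The matrix of the metric at a point in the coordinate basis. -/
noncomputable def gram (p : M) : Matrix (Fin n) (Fin n) ℝ :=
  Matrix.of fun i j ↦ g.val p (frame p i) (frame p j)

/-- Nondegeneracy makes `inv` a true inverse: Mathlib's matrix inverse defaults to 0 when the
determinant is not a unit. -/
lemma isUnit_det_gram (p : M) : IsUnit (g.gram p).det := by
  have h := (LinearMap.BilinForm.nondegenerate_iff_det_ne_zero (frame p)).mp
    (g.bilinForm_nondegenerate p)
  have e : LinearMap.BilinForm.toMatrix (frame p) (g.bilinForm p) = g.gram p := by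
    ext i j
    simp [gram, LinearMap.BilinForm.toMatrix_apply]
  rw [e] at h
  exact h.isUnit

lemma inv_mul_gram (p : M) : g.inv p * g.gram p = 1 :=
  Matrix.nonsing_inv_mul _ (g.isUnit_det_gram p)

lemma sum_inv_mul_val (p : M) (i j : Fin n) :
    ∑ k, g.inv p i k * g.val p (frame p k) (frame p j) = if i = j then 1 else 0 := by
  have h := congrFun (congrFun (g.inv_mul_gram p) i) j
  rwa [Matrix.mul_apply, Matrix.one_apply] at h

/-- The full trace of the metric is the dimension. -/
lemma sum_sum_inv_mul_val (p : M) :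
    ∑ i, ∑ k, g.inv p i k * g.val p (frame p i) (frame p k) = n := by
  have h (i : Fin n) : ∑ k, g.inv p i k * g.val p (frame p i) (frame p k) = 1 := by
    simpa [g.symm p (frame p i)] using g.sum_inv_mul_val p i i
  simp [h]

/-- The Ricci tensor, in the coordinate basis, of a curvature tensor of constant curvature. -/
lemma ricci_frame_of_curvature_eq {p : M} {κ : ℝ}
    (h : ∀ u v w z, g.curvature p u v w z =
      κ * (g.val p u w * g.val p v z - g.val p v w * g.val p u z)) (j l : Fin n) :
    g.ricci p (frame p j) (frame p l) = κ * (n - 1) * g.val p (frame p j) (frame p l) := by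
  -- The cross term contracts to a Kronecker delta, so it contributes one copy of the metric against
  -- the `n` copies from the full trace: hence the factor `n - 1`.
  have h1 (i : Fin n) : ∑ k, g.inv p i k * (g.val p (frame p j) (frame p k) *
      g.val p (frame p i) (frame p l)) =
        if i = j then g.val p (frame p i) (frame p l) else 0 := by
    have := congrArg (· * g.val p (frame p i) (frame p l)) (g.sum_inv_mul_val p i j)
    simpa [Finset.sum_mul, mul_assoc, g.symm p (frame p j)] using this
  have h2 : ∑ i, ∑ k, g.inv p i k * (g.val p (frame p j) (frame p k) *
      g.val p (frame p i) (frame p l)) = g.val p (frame p j) (frame p l) := by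
    simp [h1]
  calc g.ricci p (frame p j) (frame p l)
      = κ * ((∑ i, ∑ k, g.inv p i k * g.val p (frame p i) (frame p k)) *
          g.val p (frame p j) (frame p l) -
        ∑ i, ∑ k, g.inv p i k * (g.val p (frame p j) (frame p k) *
          g.val p (frame p i) (frame p l))) := by
        simp only [ricci, h, Finset.sum_mul, ← Finset.sum_sub_distrib, Finset.mul_sum]
        exact Finset.sum_congr rfl fun i _ ↦ Finset.sum_congr rfl fun k _ ↦ by ring
    _ = κ * (n - 1) * g.val p (frame p j) (frame p l) := by
        rw [h2, sum_sum_inv_mul_val]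
        ring

/-- The scalar curvature of a curvature tensor of constant curvature. -/
lemma scalarCurvature_of_curvature_eq {p : M} {κ : ℝ}
    (h : ∀ u v w z, g.curvature p u v w z =
      κ * (g.val p u w * g.val p v z - g.val p v w * g.val p u z)) :
    g.scalarCurvature p = κ * (n * (n - 1)) := by
  calc g.scalarCurvature p
      = κ * (n - 1) * ∑ j, ∑ l, g.inv p j l * g.val p (frame p j) (frame p l) := by
        simp only [scalarCurvature, g.ricci_frame_of_curvature_eq h, Finset.mul_sum]
        exact Finset.sum_congr rfl fun i _ ↦ Finset.sum_congr rfl fun k _ ↦ by ring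
    _ = κ * (n * (n - 1)) := by
        rw [sum_sum_inv_mul_val]
        ring

/-- If the generalized curvature tensor vanishes at a point, antisymmetry of the curvature tensor
determines its coefficients up to one parameter. -/
lemma coeff_of_genTensor_eq_zero (hn : 2 ≤ n) {a₀ a₁ a₂ a₃ : ℝ} {p : M}
    (hK : ∀ u v w z : TangentSpace (𝓡 n) p, g.genTensor a₀ a₁ a₂ a₃ p u v w z = 0) :
    a₁ = 0 ∧ a₂ = -a₃ := by
  have key (u v w z : TangentSpace (𝓡 n) p) :
      2 * a₁ * (g.val p u v * g.val p w z) + (a₂ + a₃) *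
        (g.val p u w * g.val p v z + g.val p v w * g.val p u z) = 0 := by
    have h1 := hK u v w z
    have h2 := hK v u w z
    rw [genTensor] at h1 h2
    rw [curvature_swap, g.symm p v u] at h2
    linear_combination h1 + h2
  obtain ⟨u, v, huv, hu, hv⟩ := g.exists_orthogonal_pair hn p
  have hvu : g.val p v u = 0 := by rw [g.symm, huv]
  -- Since `g(u, v) = 0`, the arguments `u u v v` isolate `a₁` and `u v u v` isolate `a₂ + a₃`.
  have h1 := key u u v v
  have h2 := key u v u v
  simp only [huv, hvu, mul_zero, add_zero, zero_add, mul_eq_zero, hu, hv, or_false,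
    OfNat.ofNat_ne_zero, false_or] at h1 h2
  exact ⟨h1, eq_neg_of_add_eq_zero_left h2⟩

end PseudoRiemannian.Metric

open PseudoRiemannian in
theorem mainTheorem7 {n : ℕ} (hn : 3 ≤ n) {M : Type*} [TopologicalSpace M]
    [ChartedSpace (EuclideanSpace ℝ (Fin n)) M] [IsManifold (𝓡 n) ∞ M] [Nonempty M]
    (g : Metric n M) (a₀ a₁ a₂ a₃ : ℝ) (ha₀ : a₀ ≠ 0)
    (hK : ∀ (p : M) (u v w z : TangentSpace (𝓡 n) p), g.genTensor a₀ a₁ a₂ a₃ p u v w z = 0) :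
    g.IsConstantCurvature ∧
    a₁ = 0 ∧ a₂ = -a₃ ∧
    (∀ p : M, a₂ = -a₀ * g.scalarCurvature p / ((n : ℝ) * ((n : ℝ) - 1))) ∧
    (∀ (p : M) (u v w z : TangentSpace (𝓡 n) p),
      g.genTensor a₀ a₁ a₂ a₃ p u v w z = a₀ * g.concircular p u v w z) := by
  -- One point suffices to determine relations between constants.
  obtain ⟨p₀⟩ := ‹Nonempty M›
  obtain ⟨h1, h23⟩ := g.coeff_of_genTensor_eq_zero (by omega) (hK p₀)
  have hR (p : M) (u v w z : TangentSpace (𝓡 n) p) : g.curvature p u v w z =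
      -a₂ / a₀ * (g.val p u w * g.val p v z - g.val p v w * g.val p u z) := by
    have h := hK p u v w z
    rw [Metric.genTensor] at h
    field_simp
    linear_combination h - g.val p u v * g.val p w z * h1 - g.val p v w * g.val p u z * h23
  have hn' : (n : ℝ) * ((n : ℝ) - 1) ≠ 0 := by
    have : (3 : ℝ) ≤ n := by exact_mod_cast hn
    exact mul_ne_zero (by linarith) (by linarith)
  have hτ (p : M) : g.scalarCurvature p / ((n : ℝ) * ((n : ℝ) - 1)) = -a₂ / a₀ := by
    rw [g.scalarCurvature_of_curvature_eq (hR p), mul_div_cancel_right₀ _ hn']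
  refine ⟨⟨-a₂ / a₀, fun p u v huv ↦ ?_⟩, h1, h23, fun p ↦ ?_, fun p u v w z ↦ ?_⟩
  · rw [Metric.sectionalCurvature, div_eq_iff huv, hR, Metric.area, g.symm p v u]
    ring
  · rw [mul_div_assoc, hτ]
    field_simp
  -- Both sides vanish: the left by hypothesis, the right because the curvature equals its
  -- constant-curvature model.
  · rw [hK, Metric.concircular, hτ, hR, sub_self, mul_zero]
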